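/- Let $\mathbb S=\{I\in\mathbb H: I^2=-1\}$ and, for $z=x+iy\in\mathbb C$, let $\mathbb S_z=\{x+Iy: I\in\mathbb S\}$. For $D\subset\mathbb C$ open and symmetric with respect to the real axis, put $\Omega_D=\bigcup_{z\in D}\mathbb S_z$. A function $f:\Omega_D\to\mathbb H$ is slice regular if there is a holomorphic map $F=F_1+F_2\iota:D\to\mathbb H\otimes_{\mathbb R}\mathbb C$ with $F(\bar z)=\overline{F(z)}$ such that $f(x+Iy)=F_1(x+iy)+I\,F_2(x+iy)$ for all $x+iy\in D$ and $I\in\mathbb S$; we write $f=\mathcal I(F)$, and $\mathcal I(F)*\mathcal I(G):=\mathcal I(FG)$ is the slice product. Let $f$ be slice regular near $\mathbb S_z$, $z=x+iy$. If $y\neq0$, the multiplicity $s_z$ of $\mathbb S_z$ as a spherical zero is the largest $s\ge0$ such that $f(q)=((q-x)^2+y^2)^s*h(q)$ near $\mathbb S_z$ with $h$ slice regular; if $y=0$, put $s_z=0$. The multiplicity $n_z$ of the punctual (isolated or real) zero on $\mathbb S_z$ is the largest $n\ge 0$ such that, near $\mathbb S_z$, $$f(q)=((q-x)^2+y^2)^{s_z}*(q-a_1)*\cdots*(q-a_n)*g(q)$$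 with $a_1,\dots,a_n\in\mathbb S_z$ and $g$ slice regular. Let $P_f(r)=\sum n_z$ and $S_f(r)=\sum s_z$, both sums over all $z$ with $\operatorname{Im}z\ge0$ and $|z|\le r$ (the punctual, respectively spherical, zeros of $f$ in the closed ball of radius $r$, counted with multiplicities). Let $n_f(r)=P_f(r)+2S_f(r)$ and $M_f(r)=\sup_{|q|=r}|f(q)|$. Corollary. Let $R>0$ and let $f$ be slice regular on some $\Omega_D$ which contains the closed ball $\{q\in\mathbb H:|q|\le R\}$, with $f(0)\ne0$. Then for every $0<r<R$ the number $n_f(r)$ is finite and $$n_f(r)=P_f(r)+2S_f(r)\le\frac{\log M_f(R)-\log|f(0)|}{\log R-\log r}.$$ -/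

import Mathlib

open scoped Quaternion

noncomputable section

namespace SliceRegular

/-- The sphere `𝕊` of quaternionic imaginary units. -/
def imagUnits : Set ℍ[ℝ] := {I | I * I = -1}

/-- The 2-sphere `𝕊_z = {x + I y : I ∈ 𝕊}` attached to `z = x + i y` (the single point `x` when
`y = 0`). -/
def sphereOf (z : ℂ) : Set ℍ[ℝ] :=
  {q | ∃ I ∈ imagUnits, q = (z.re : ℍ[ℝ]) + I * (z.im : ℍ[ℝ])}

/-- The circularization `Ω_D` of a set `D` of complex numbers. -/
def circularization (D : Set ℂ) : Set ℍ[ℝ] := {q | ∃ z ∈ D, q ∈ sphereOf z}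

/-- `D` is symmetric with respect to the real axis. -/
def IsSymm (D : Set ℂ) : Prop := ∀ z ∈ D, (starRingEnd ℂ) z ∈ D

/-! The complexification `ℍ ⊗_ℝ ℂ = {p + q ι : p, q ∈ ℍ}` is Mathlib's algebra `ℍ[ℂ]` of
quaternions with complex coefficients, in which `ι` is the scalar `Complex.I`. Its `star` is
the quaternionic conjugation `(p + q ι)ᶜ = pᶜ + qᶜ ι`. -/

/-- The component `p` of `p + q ι`. -/
def fstPart (w : ℍ[ℂ]) : ℍ[ℝ] := ⟨w.re.re, w.imI.re, w.imJ.re, w.imK.re⟩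

/-- The component `q` of `p + q ι`. -/
def sndPart (w : ℍ[ℂ]) : ℍ[ℝ] := ⟨w.re.im, w.imI.im, w.imJ.im, w.imK.im⟩

/-- The element `p + 0 ι` of the complexification. -/
def ofQuat (p : ℍ[ℝ]) : ℍ[ℂ] := ⟨p.re, p.imI, p.imJ, p.imK⟩

/-- The complex conjugation `p + q ι ↦ p - q ι` of the complexification. -/
def cconj (w : ℍ[ℂ]) : ℍ[ℂ] :=
  ⟨(starRingEnd ℂ) w.re, (starRingEnd ℂ) w.imI, (starRingEnd ℂ) w.imJ, (starRingEnd ℂ) w.imK⟩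

/-- `F` is a stem function on `D`: `F(z̄)` is the conjugate of `F(z)`. -/
def IsStem (F : ℂ → ℍ[ℂ]) (D : Set ℂ) : Prop :=
  ∀ z ∈ D, F ((starRingEnd ℂ) z) = cconj (F z)

/-- Holomorphy of a map into `ℍ ⊗ ℂ ≃ ℂ⁴`. -/
def IsHolo (F : ℂ → ℍ[ℂ]) (D : Set ℂ) : Prop :=
  DifferentiableOn ℂ (fun z => (F z).re) D ∧ DifferentiableOn ℂ (fun z => (F z).imI) D ∧
    DifferentiableOn ℂ (fun z => (F z).imJ) D ∧ DifferentiableOn ℂ (fun z => (F z).imK) D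

/-- `f = 𝓘(F)` on `Ω_D`: `f(x + I y) = F₁(x + i y) + I F₂(x + i y)` where `F = F₁ + F₂ ι`. -/
def Induces (F : ℂ → ℍ[ℂ]) (D : Set ℂ) (f : ℍ[ℝ] → ℍ[ℝ]) : Prop :=
  ∀ z ∈ D, ∀ I ∈ imagUnits,
    f ((z.re : ℍ[ℝ]) + I * (z.im : ℍ[ℝ])) = fstPart (F z) + I * sndPart (F z)

/-- `f` is slice regular on `Ω_D`. Only the values of `f` on `Ω_D` matter. -/
def IsSliceRegular (f : ℍ[ℝ] → ℍ[ℝ]) (D : Set ℂ) : Prop :=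
  ∃ F : ℂ → ℍ[ℂ], IsStem F D ∧ IsHolo F D ∧ Induces F D f

/-- The stem function of the slice polynomial `(q - x)² + y²`, whose zero set is `𝕊_z`,
`z = x + i y`. -/
def sphStem (z w : ℂ) : ℍ[ℂ] := (((w - (z.re : ℂ)) ^ 2 + (z.im : ℂ) ^ 2 : ℂ) : ℍ[ℂ])

/-- The stem function of the linear slice polynomial `q - a`. -/
def linStem (a : ℍ[ℝ]) (w : ℂ) : ℍ[ℂ] := (w : ℍ[ℂ]) - ofQuat a

/-- In a circular neighbourhood of `𝕊_z`, `z = x + i y`, the function `f` is the slice product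
`((q - x)² + y²)^s * (q - a₁) * ⋯ * (q - aₙ) * g(q)` with `g` slice regular. Here `as` is the list
`a₁, …, aₙ`, and the slice product of `𝓘(F)` and `𝓘(G)` is `𝓘(F G)`. -/
def Factors (f : ℍ[ℝ] → ℍ[ℝ]) (z : ℂ) (s : ℕ) (as : List ℍ[ℝ]) : Prop :=
  ∃ (D : Set ℂ) (G : ℂ → ℍ[ℂ]), IsOpen D ∧ IsSymm D ∧ z ∈ D ∧ IsStem G D ∧ IsHolo G D ∧
    Induces (fun w => sphStem z w ^ s * (as.map (fun a => linStem a w)).prod * G w) D f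

open Classical in
/-- The multiplicity of `𝕊_z` as a spherical zero of `f`: the largest `s` such that
`((q - x)² + y²)^s` divides `f` near `𝕊_z` (and `0` if `z` is real, as `𝕊_z` is then a point). -/
def sphericalMult (f : ℍ[ℝ] → ℍ[ℝ]) (z : ℂ) : ℕ∞ :=
  if z.im = 0 then 0 else ⨆ (s : ℕ) (_ : Factors f z s []), (s : ℕ∞)

/-- The multiplicity of the punctual zero of `f` on `𝕊_z`: the largest number `n` of linear factors
`q - a₁, …, q - aₙ`, `aᵢ ∈ 𝕊_z`, which can be split off on the left from the quotient of `f` by the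
highest power of `(q - x)² + y²` that divides it. For real `z` this is the multiplicity of the real
point `z` as a zero of `f`. -/
def punctualMult (f : ℍ[ℝ] → ℍ[ℝ]) (z : ℂ) : ℕ∞ :=
  ⨆ (s : ℕ) (as : List ℍ[ℝ]) (_ : (s : ℕ∞) = sphericalMult f z ∧ (∀ a ∈ as, a ∈ sphereOf z) ∧
    Factors f z s as), (as.length : ℕ∞)

/-- The sum of the extended natural numbers `m z` over all `z` in the closed upper half plane with
`|z| ≤ r`; these `z` parametrize the sets `𝕊_z` in the closed ball of radius `r`. -/
def sumOver (m : ℂ → ℕ∞) (r : ℝ) : ℕ∞ :=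
  ⨆ (T : Finset ℂ) (_ : ∀ z ∈ T, 0 ≤ z.im ∧ ‖z‖ ≤ r), ∑ z ∈ T, m z

/-- `P_f(r)`: the number of punctual zeros in the closed ball of radius `r`, with multiplicities. -/
def punctualCount (f : ℍ[ℝ] → ℍ[ℝ]) (r : ℝ) : ℕ∞ := sumOver (punctualMult f) r

/-- `S_f(r)`: the number of spherical zeros in the closed ball of radius `r`, with
multiplicities. -/
def sphericalCount (f : ℍ[ℝ] → ℍ[ℝ]) (r : ℝ) : ℕ∞ := sumOver (sphericalMult f) r

/-- `n_f(r) = P_f(r) + 2 S_f(r)`. -/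
def zeroCount (f : ℍ[ℝ] → ℍ[ℝ]) (r : ℝ) : ℕ∞ := punctualCount f r + 2 * sphericalCount f r

/-- `M_f(r) = sup {|f(q)| : |q| = r}`. -/
def maxModulus (f : ℍ[ℝ] → ℍ[ℝ]) (r : ℝ) : ℝ :=
  sSup ((fun q : ℍ[ℝ] => ‖f q‖) '' Metric.sphere 0 r)

end SliceRegular

end

/-! The problem reduces to Jensen's inequality for one holomorphic function, the normal function N =
`Quaternion.normSq` ∘ F of the stem function F. Over ℂ this quadratic form is not a norm, but it is
still multiplicative and polynomial in the components, so N is holomorphic. A factor (q - x)² + y²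
of f contributes its square to N, and a factor q - a with a ∈ 𝕊_z contributes (w - z)(w - z̄). A
non-real 𝕊_z of total multiplicity n_z + 2 s_z therefore forces at least that order of N at both z
and z̄; at a real z the two factors merge and the order is at least 2 n_z (`Factors.le_order`).
Hence N has at least 2 n_f(r) zeros in the disc of radius r. On |z| = R the parallelogram law gives
|N| ≤ |F₁|² + |F₂|² ≤ M_f(R)², and N(0) = |f(0)|². Jensen's bound (`analytic_zeros_bound`) for N is
then twice the desired one. -/

namespace SliceRegular

open Metric ComplexConjugate

/-! ### Jensen's bound for holomorphic functions -/

section Complex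

open MeromorphicOn

/-- Zeros of an analytic function in a smaller disc: finitely many, of finite order, and their
number is controlled by the maximum on the larger circle. -/
theorem analytic_zeros_bound {N : ℂ → ℂ} {r R B : ℝ} (hr : 0 < r) (hrR : r < R)
    (hN : AnalyticOnNhd ℂ N (closedBall 0 R)) (hN0 : N 0 ≠ 0)
    (hB : ∀ z ∈ sphere (0 : ℂ) R, ‖N z‖ ≤ B) :
    ‖N 0‖ ≤ B ∧ (∃ A : Finset ℂ, ∀ u ∈ closedBall (0 : ℂ) r, u ∉ A → analyticOrderNatAt N u = 0) ∧
      (∀ u ∈ closedBall (0 : ℂ) r, analyticOrderAt N u ≠ ⊤) ∧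
      ∀ T : Finset ℂ, (∀ u ∈ T, u ∈ closedBall (0 : ℂ) r) →
        ((∑ u ∈ T, analyticOrderNatAt N u : ℕ) : ℝ) ≤
          (Real.log B - Real.log ‖N 0‖) / (Real.log R - Real.log r) := by
  have hR : 0 < R := hr.trans hrR
  have hle : ‖N 0‖ ≤ B := by
    refine Complex.norm_le_of_forall_mem_frontier_norm_le (U := ball (0 : ℂ) R) isBounded_ball
      ?_ ?_ ?_
    · apply DifferentiableOn.diffContOnCl
      rw [closure_ball _ hR.ne']
      exact hN.differentiableOn
    · rwa [frontier_ball _ hR.ne']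
    · rw [closure_ball _ hR.ne']
      exact mem_closedBall_self hR.le
  have hBpos : 0 < B := (norm_pos_iff.2 hN0).trans_le hle
  -- Dividing by B, positive by the maximum principle, gives bound 1 on the outer circle and leaves
  -- the zeros unchanged.
  set g : ℂ → ℂ := fun z => ((B : ℂ)⁻¹) * N z with hg
  have hB0 : (B : ℂ) ≠ 0 := by exact_mod_cast hBpos.ne'
  have hga : AnalyticOnNhd ℂ g (closedBall 0 R) := fun z hz => analyticAt_const.mul (hN z hz)
  have hsub : closedBall (0 : ℂ) r ⊆ closedBall 0 R := closedBall_subset_closedBall hrR.le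
  have hord : ∀ u ∈ closedBall (0 : ℂ) R, analyticOrderAt g u = analyticOrderAt N u := by
    intro u hu
    have h1 : analyticOrderAt g u =
        analyticOrderAt (fun _ : ℂ => (B : ℂ)⁻¹) u + analyticOrderAt N u :=
      analyticOrderAt_mul analyticAt_const (hN u hu)
    have h2 : analyticOrderAt (fun _ : ℂ => (B : ℂ)⁻¹) u = 0 :=
      analyticAt_const.analyticOrderAt_eq_zero.2 (inv_ne_zero hB0)
    rw [h1, h2, zero_add]
  have htop : ∀ u ∈ closedBall (0 : ℂ) R, analyticOrderAt N u ≠ ⊤ := by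
    intro u hu
    refine hN.analyticOrderAt_ne_top_of_isPreconnected (convex_closedBall _ _).isPreconnected
      (mem_closedBall_self hR.le) hu ?_
    rw [(hN 0 (mem_closedBall_self hR.le)).analyticOrderAt_eq_zero.2 hN0]
    simp
  have hdiv : ∀ u ∈ closedBall (0 : ℂ) r,
      divisor g (closedBall 0 r) u = analyticOrderNatAt N u := by
    intro u hu
    rw [(hga.mono hsub).divisor_apply hu, hord u (hsub hu),
      ← Nat.cast_analyticOrderNatAt (htop u (hsub hu))]
    rfl
  have hfin : (divisor g (closedBall 0 r)).support.Finite :=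
    (divisor g (closedBall 0 r)).finiteSupport (isCompact_closedBall _ _)
  refine ⟨hle, ⟨hfin.toFinset, fun u hu hA => ?_⟩, fun u hu => htop u (hsub hu), fun T hT => ?_⟩
  · have : divisor g (closedBall 0 r) u = 0 := by simpa using hA
    rw [hdiv u hu] at this
    exact_mod_cast this
  · have key := AnalyticOnNhd.sum_divisor_le (c := 0) (r := r) (R := R) (M := 1) (f := g)
      (by rwa [abs_of_pos hr]) (by rwa [abs_of_pos hr, abs_of_pos hR]) le_rfl
      (by rwa [abs_of_pos hR]) (by simp [hg, hN0, hB0])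
      (by
        rw [abs_of_pos hR]
        intro z hz
        rw [hg, norm_mul, norm_inv, Complex.norm_real, Real.norm_of_nonneg hBpos.le,
          inv_mul_le_iff₀ hBpos, mul_one]
        exact hB z hz)
    rw [abs_of_pos hr] at key
    have hlog : Real.log (1 / ‖g 0‖) = Real.log B - Real.log ‖N 0‖ := by
      rw [hg, norm_mul, norm_inv, Complex.norm_real, Real.norm_of_nonneg hBpos.le, one_div,
        mul_inv, inv_inv, ← div_eq_mul_inv, Real.log_div hBpos.ne' (norm_ne_zero_iff.2 hN0)]
    rw [hlog, Real.log_div hR.ne' hr.ne'] at key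
    refine le_trans ?_ key
    have h2 : ((∑ u ∈ T, analyticOrderNatAt N u : ℕ) : ℤ) ≤
        ∑ᶠ u, divisor g (closedBall 0 r) u := by
      classical
      -- T need not contain the support of the divisor, nor lie in it; the union accommodates both,
      -- and the extra terms are nonnegative.
      rw [finsum_eq_sum_of_support_subset (s := T ∪ hfin.toFinset) _ fun x hx =>
        Finset.mem_coe.2 (Finset.mem_union_right T (hfin.mem_toFinset.2 hx))]
      push_cast
      rw [Finset.sum_congr rfl fun u hu => (hdiv u (hT u hu)).symm]
      exact Finset.sum_le_sum_of_subset_of_nonneg Finset.subset_union_left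
        fun i _ _ => (hga.mono hsub).divisor_nonneg i
    exact_mod_cast h2

end Complex

/-! ### Quaternionic algebra and the complexification -/

section Algebra

theorem imagUnits_iff {I : ℍ[ℝ]} :
    I ∈ imagUnits ↔ I.re = 0 ∧ I.imI ^ 2 + I.imJ ^ 2 + I.imK ^ 2 = 1 := by
  constructor
  · intro h
    have h : I * I = -1 := h
    have h0 := congrArg QuaternionAlgebra.re h
    have h1 := congrArg QuaternionAlgebra.imI h
    have h2 := congrArg QuaternionAlgebra.imJ h
    have h3 := congrArg QuaternionAlgebra.imK h
    simp at h0 h1 h2 h3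
    have hre : I.re = 0 := by
      -- The imaginary components of I² = -1 are 2 re(I) times those of I; if re(I) ≠ 0 they vanish,
      -- leaving re(I)² = -1.
      by_contra hne
      have e1 : I.imI = 0 := by
        apply mul_left_cancel₀ hne; linarith
      have e2 : I.imJ = 0 := by
        apply mul_left_cancel₀ hne; linarith
      have e3 : I.imK = 0 := by
        apply mul_left_cancel₀ hne; linarith
      rw [e1, e2, e3] at h0
      nlinarith [sq_nonneg I.re]
    rw [hre] at h0
    exact ⟨hre, by linarith⟩
  · rintro ⟨h0, h1⟩
    change I * I = -1
    ext <;> simp [h0] <;> linarith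

theorem neg_mem_imagUnits {I : ℍ[ℝ]} (h : I ∈ imagUnits) : -I ∈ imagUnits := by
  have h : I * I = -1 := h
  change -I * -I = -1
  rw [neg_mul_neg, h]

/-- The imaginary unit `i`. -/
def unitI : ℍ[ℝ] := ⟨0, 1, 0, 0⟩

theorem unitI_mem : unitI ∈ imagUnits :=
  imagUnits_iff.2 ⟨rfl, by simp [unitI]⟩

theorem norm_sq_eq (q : ℍ[ℝ]) : ‖q‖ ^ 2 = q.re ^ 2 + q.imI ^ 2 + q.imJ ^ 2 + q.imK ^ 2 := by
  rw [sq, ← Quaternion.normSq_eq_norm_mul_self, Quaternion.normSq_def']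

theorem norm_imagUnit {I : ℍ[ℝ]} (h : I ∈ imagUnits) : ‖I‖ = 1 := by
  obtain ⟨h0, h1⟩ := imagUnits_iff.1 h
  have := norm_sq_eq I
  rw [h0] at this
  nlinarith [norm_nonneg I]

theorem norm_sphere_point {z : ℂ} {q : ℍ[ℝ]} (h : q ∈ sphereOf z) : ‖q‖ = ‖z‖ := by
  obtain ⟨I, hI, rfl⟩ := h
  obtain ⟨h0, h1⟩ := imagUnits_iff.1 hI
  refine (sq_eq_sq₀ (norm_nonneg _) (norm_nonneg _)).1 ?_
  rw [norm_sq_eq, Complex.sq_norm, Complex.normSq_apply]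
  simp [h0]
  linear_combination z.im ^ 2 * h1

theorem normSq_sphStem (z w : ℂ) :
    Quaternion.normSq (sphStem z w) = ((w - (z.re : ℂ)) ^ 2 + (z.im : ℂ) ^ 2) ^ 2 := by
  rw [sphStem, Quaternion.normSq_coe]

@[simp] theorem ofQuat_re (p : ℍ[ℝ]) : (ofQuat p).re = p.re := rfl

@[simp] theorem ofQuat_imI (p : ℍ[ℝ]) : (ofQuat p).imI = p.imI := rfl

@[simp] theorem ofQuat_imJ (p : ℍ[ℝ]) : (ofQuat p).imJ = p.imJ := rfl

@[simp] theorem ofQuat_imK (p : ℍ[ℝ]) : (ofQuat p).imK = p.imK := rfl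

theorem normSq_linStem {a : ℍ[ℝ]} {z : ℂ} (h : a ∈ sphereOf z) (w : ℂ) :
    Quaternion.normSq (linStem a w) = (w - (z.re : ℂ)) ^ 2 + (z.im : ℂ) ^ 2 := by
  obtain ⟨I, hI, rfl⟩ := h
  obtain ⟨h0, h1⟩ := imagUnits_iff.1 hI
  have h1' : (I.imI : ℂ) ^ 2 + (I.imJ : ℂ) ^ 2 + (I.imK : ℂ) ^ 2 = 1 := by exact_mod_cast h1
  rw [Quaternion.normSq_def']
  simp [linStem, h0]
  linear_combination (z.im : ℂ) ^ 2 * h1'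

theorem normSq_linStem_prod {z : ℂ} {as : List ℍ[ℝ]} (h : ∀ a ∈ as, a ∈ sphereOf z) (w : ℂ) :
    Quaternion.normSq (as.map fun a => linStem a w).prod =
      ((w - (z.re : ℂ)) ^ 2 + (z.im : ℂ) ^ 2) ^ as.length := by
  induction as with
  | nil => simp
  | cons a as ih =>
    rw [List.map_cons, List.prod_cons, map_mul, normSq_linStem (h a (by simp)),
      ih fun b hb => h b (by simp [hb]), List.length_cons, pow_succ' _ as.length]

/-- Adding and subtracting the identities for I and -I isolates the two components. -/
theorem eq_of_parts_eq {A B : ℍ[ℂ]} (h : ∀ I ∈ imagUnits,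
    fstPart A + I * sndPart A = fstPart B + I * sndPart B) : A = B := by
  have h1 := h _ unitI_mem
  have h2 := h _ (neg_mem_imagUnits unitI_mem)
  rw [neg_mul, neg_mul, ← sub_eq_add_neg, ← sub_eq_add_neg] at h2
  have e : fstPart A = fstPart B := by
    have h12 := congrArg₂ (· + ·) h1 h2
    simp only [add_add_sub_cancel] at h12
    rwa [← two_smul ℝ, ← two_smul ℝ (fstPart B), smul_right_inj two_ne_zero] at h12
  have e' : sndPart A = sndPart B := by
    rw [e] at h1
    refine mul_left_cancel₀ (norm_ne_zero_iff.1 ?_) (add_left_cancel h1)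
    rw [norm_imagUnit unitI_mem]
    exact one_ne_zero
  ext <;> apply Complex.ext
  exacts [congrArg (·.re) e, congrArg (·.re) e', congrArg (·.imI) e, congrArg (·.imI) e',
    congrArg (·.imJ) e, congrArg (·.imJ) e', congrArg (·.imK) e, congrArg (·.imK) e']

/-- The sum of the squared norms of the two components of an element of the complexification. -/
noncomputable def partsNormSq (A : ℍ[ℂ]) : ℝ := ‖fstPart A‖ ^ 2 + ‖sndPart A‖ ^ 2

theorem partsNormSq_eq (A : ℍ[ℂ]) :
    partsNormSq A = ‖A.re‖ ^ 2 + ‖A.imI‖ ^ 2 + ‖A.imJ‖ ^ 2 + ‖A.imK‖ ^ 2 := by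
  rw [partsNormSq, norm_sq_eq, norm_sq_eq]
  simp only [Complex.sq_norm, Complex.normSq_apply, fstPart, sndPart]
  ring

theorem norm_normSq_le (A : ℍ[ℂ]) : ‖Quaternion.normSq A‖ ≤ partsNormSq A := by
  rw [partsNormSq_eq, Quaternion.normSq_def', ← norm_pow, ← norm_pow, ← norm_pow, ← norm_pow]
  exact (norm_add_le _ _).trans (by gcongr; exact norm_add₃_le)

/-- The parallelogram law for p ± Iq, with |Iq| = |q|, bounds |p|² + |q|² by the mean of the two
squared norms, with no loss of constant. -/
theorem partsNormSq_le {A : ℍ[ℂ]} {C : ℝ}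
    (h : ∀ I ∈ imagUnits, ‖fstPart A + I * sndPart A‖ ≤ C) : partsNormSq A ≤ C ^ 2 := by
  have h1 := h _ unitI_mem
  have h2 := h _ (neg_mem_imagUnits unitI_mem)
  have p := parallelogram_law_with_norm ℝ (fstPart A) (unitI * sndPart A)
  rw [neg_mul, ← sub_eq_add_neg] at h2
  rw [norm_mul, norm_imagUnit unitI_mem, one_mul] at p
  rw [partsNormSq]
  nlinarith [pow_le_pow_left₀ (norm_nonneg _) h1 2, pow_le_pow_left₀ (norm_nonneg _) h2 2]

theorem norm_parts_le (A : ℍ[ℂ]) {I : ℍ[ℝ]} (hI : I ∈ imagUnits) :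
    ‖fstPart A + I * sndPart A‖ ^ 2 ≤ 2 * partsNormSq A := by
  have h := norm_add_le (fstPart A) (I * sndPart A)
  rw [norm_mul, norm_imagUnit hI, one_mul] at h
  rw [partsNormSq]
  nlinarith [pow_le_pow_left₀ (norm_nonneg _) h 2, sq_nonneg (‖fstPart A‖ - ‖sndPart A‖)]

end Algebra

/-! ### Stem functions and the normal function -/

section Stem

theorem mem_or_conj_mem {D : Set ℂ} {z : ℂ} {I : ℍ[ℝ]} (hI : I ∈ imagUnits)
    (h : (z.re : ℍ[ℝ]) + I * (z.im : ℍ[ℝ]) ∈ circularization D) : z ∈ D ∨ conj z ∈ D := by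
  obtain ⟨w, hw, hq⟩ := h
  have hn : ‖z‖ = ‖w‖ := (norm_sphere_point ⟨I, hI, rfl⟩).symm.trans (norm_sphere_point hq)
  obtain ⟨J, hJ, hq⟩ := hq
  have hre := congrArg QuaternionAlgebra.re hq
  simp [(imagUnits_iff.1 hI).1, (imagUnits_iff.1 hJ).1] at hre
  have hsq : z.im ^ 2 = w.im ^ 2 := by
    have := congrArg (· ^ 2) hn
    simp only [Complex.sq_norm, Complex.normSq_apply, hre] at this
    linarith
  rcases sq_eq_sq_iff_eq_or_eq_neg.1 hsq with h | h
  · left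
    rwa [Complex.ext hre h]
  · right
    rwa [show conj z = w from Complex.ext (by simpa using hre) (by simp [h])]

theorem closedBall_subset_of_circularization {D : Set ℂ} {R : ℝ} (hD : IsSymm D)
    (h : closedBall (0 : ℍ[ℝ]) R ⊆ circularization D) : closedBall (0 : ℂ) R ⊆ D := by
  intro z hz
  rcases mem_or_conj_mem unitI_mem (h (a := (z.re : ℍ[ℝ]) + unitI * (z.im : ℍ[ℝ])) (by
    rw [mem_closedBall_zero_iff, norm_sphere_point ⟨_, unitI_mem, rfl⟩]
    simpa using hz)) with h | h
  · exact h
  · simpa using hD _ h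

theorem IsHolo.differentiableOn_normSq {F : ℂ → ℍ[ℂ]} {D : Set ℂ} (h : IsHolo F D) :
    DifferentiableOn ℂ (fun z => Quaternion.normSq (F z)) D := by
  obtain ⟨h0, h1, h2, h3⟩ := h
  simp only [Quaternion.normSq_def']
  exact (((h0.pow 2).add (h1.pow 2)).add (h2.pow 2)).add (h3.pow 2)

theorem IsHolo.continuousOn_partsNormSq {F : ℂ → ℍ[ℂ]} {D : Set ℂ} (h : IsHolo F D) :
    ContinuousOn (fun z => partsNormSq (F z)) D := by
  obtain ⟨h0, h1, h2, h3⟩ := h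
  simp only [partsNormSq_eq]
  exact (((h0.continuousOn.norm.pow 2).add (h1.continuousOn.norm.pow 2)).add
    (h2.continuousOn.norm.pow 2)).add (h3.continuousOn.norm.pow 2)

/-- The stem function is determined pointwise by f, so a local factorization of f is one of the
global F. -/
theorem Induces.eq_of_mem {F G : ℂ → ℍ[ℂ]} {D E : Set ℂ} {f : ℍ[ℝ] → ℍ[ℝ]} (hF : Induces F D f)
    (hG : Induces G E f) {w : ℂ} (hwD : w ∈ D) (hwE : w ∈ E) : F w = G w :=
  eq_of_parts_eq fun I hI => (hF w hwD I hI).symm.trans (hG w hwE I hI)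

/-- At z = 0 the point x + Iy does not depend on I, which forces F₂(0) = 0 and F₁(0) = f(0). -/
theorem Induces.normSq_zero {F : ℂ → ℍ[ℂ]} {D : Set ℂ} {f : ℍ[ℝ] → ℍ[ℝ]} (hF : Induces F D f)
    (h0 : (0 : ℂ) ∈ D) : Quaternion.normSq (F 0) = ((‖f 0‖ ^ 2 : ℝ) : ℂ) := by
  have h : F 0 = ofQuat (f 0) := eq_of_parts_eq fun I hI => by
    rw [← hF 0 h0 I hI]
    have h2 : sndPart (ofQuat (f 0)) = 0 := by ext <;> simp [sndPart, ofQuat]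
    have h1 : fstPart (ofQuat (f 0)) = f 0 := by ext <;> simp [fstPart, ofQuat]
    rw [h1, h2]
    simp
  rw [h, Quaternion.normSq_def', norm_sq_eq]
  simp

/-- Needed because `sSup` of an unbounded set of reals is 0, so `maxModulus` would not dominate the
values of f. -/
theorem Induces.bddAbove_sphere {F : ℂ → ℍ[ℂ]} {D : Set ℂ} {f : ℍ[ℝ] → ℍ[ℝ]} {R : ℝ}
    (hFh : IsHolo F D) (hF : Induces F D f) (hD : IsSymm D)
    (h : closedBall (0 : ℍ[ℝ]) R ⊆ circularization D) :
    BddAbove ((fun q : ℍ[ℝ] => ‖f q‖) '' sphere 0 R) := by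
  have hsub : sphere (0 : ℂ) R ⊆ D :=
    sphere_subset_closedBall.trans (closedBall_subset_of_circularization hD h)
  obtain ⟨C, hC⟩ := ((isCompact_sphere (0 : ℂ) R).bddAbove_image
    (hFh.continuousOn_partsNormSq.mono hsub))
  refine ⟨Real.sqrt (2 * C), ?_⟩
  rintro _ ⟨q, hq, rfl⟩
  obtain ⟨z, hz, hqz⟩ := h (sphere_subset_closedBall hq)
  have hn := norm_sphere_point hqz
  obtain ⟨I, hI, rfl⟩ := hqz
  apply Real.le_sqrt_of_sq_le
  beta_reduce
  rw [hF z hz I hI]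
  have hC' : partsNormSq (F z) ≤ C := hC ⟨z, by simpa [hn] using hq, rfl⟩
  linarith [norm_parts_le (F z) hI]

theorem Induces.norm_normSq_le_maxModulus {F : ℂ → ℍ[ℂ]} {D : Set ℂ} {f : ℍ[ℝ] → ℍ[ℝ]} {R : ℝ}
    (hFh : IsHolo F D) (hF : Induces F D f) (hD : IsSymm D)
    (h : closedBall (0 : ℍ[ℝ]) R ⊆ circularization D) {z : ℂ} (hz : z ∈ sphere (0 : ℂ) R) :
    ‖Quaternion.normSq (F z)‖ ≤ maxModulus f R ^ 2 := by
  refine (norm_normSq_le _).trans (partsNormSq_le fun I hI => ?_)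
  rw [← hF z (closedBall_subset_of_circularization hD h (sphere_subset_closedBall hz)) I hI]
  refine le_csSup (hF.bddAbove_sphere hFh hD h) ⟨_, ?_, rfl⟩
  rw [mem_sphere_zero_iff_norm, norm_sphere_point ⟨I, hI, rfl⟩]
  simpa using hz

end Stem

/-! ### Multiplicities against orders of the normal function -/

section Multiplicity

theorem sq_add_sq_eq_mul (z w : ℂ) :
    (w - (z.re : ℂ)) ^ 2 + (z.im : ℂ) ^ 2 = (w - z) * (w - conj z) := by
  have h1 := Complex.add_conj z
  have h2 := Complex.mul_conj z
  rw [Complex.normSq_apply] at h2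
  push_cast at h1 h2
  linear_combination w * h1 - h2

/-- The normal function of a slice function with a given factorization near `𝕊_z`. -/
theorem Factors.exists_normSq_eq {F : ℂ → ℍ[ℂ]} {D : Set ℂ} {f : ℍ[ℝ] → ℍ[ℝ]} {z : ℂ} {s : ℕ}
    {as : List ℍ[ℝ]} (hF : Induces F D f) (h : Factors f z s as)
    (has : ∀ a ∈ as, a ∈ sphereOf z) :
    ∃ (E : Set ℂ) (H : ℂ → ℂ), IsOpen E ∧ z ∈ E ∧ conj z ∈ E ∧ DifferentiableOn ℂ H E ∧
      ∀ w ∈ D ∩ E, Quaternion.normSq (F w) =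
        ((w - z) * (w - conj z)) ^ (2 * s + as.length) * H w := by
  obtain ⟨E, G, hE, hEs, hz, -, hG, hind⟩ := h
  refine ⟨E, fun w => Quaternion.normSq (G w), hE, hz, hEs z hz, hG.differentiableOn_normSq, ?_⟩
  rintro w ⟨hwD, hwE⟩
  rw [hF.eq_of_mem hind hwD hwE, map_mul, map_mul, map_pow, normSq_sphStem,
    normSq_linStem_prod has, sq_add_sq_eq_mul, pow_add, pow_mul]

theorem natCast_le_analyticOrderAt_of_eqOn {N H : ℂ → ℂ} {U : Set ℂ} {z : ℂ} {k : ℕ}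
    (hU : IsOpen U) (hz : z ∈ U) (hN : DifferentiableOn ℂ N U) (hH : DifferentiableOn ℂ H U)
    (h : ∀ w ∈ U, N w = (w - z) ^ k * H w) : (k : ℕ∞) ≤ analyticOrderAt N z := by
  have hUz := hU.mem_nhds hz
  refine (natCast_le_analyticOrderAt (hN.analyticAt hUz)).2 ⟨H, hH.analyticAt hUz, ?_⟩
  filter_upwards [hUz] with w hw
  simpa using h w hw

theorem Factors.le_order {F : ℂ → ℍ[ℂ]} {D : Set ℂ} {f : ℍ[ℝ] → ℍ[ℝ]} {z : ℂ} {s : ℕ}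
    {as : List ℍ[ℝ]} (hDo : IsOpen D) (hD : IsSymm D) (hFh : IsHolo F D) (hF : Induces F D f)
    (hz : z ∈ D) (h : Factors f z s as) (has : ∀ a ∈ as, a ∈ sphereOf z) :
    ((2 * s + as.length : ℕ) : ℕ∞) ≤ analyticOrderAt (fun w => Quaternion.normSq (F w)) z ∧
    ((2 * s + as.length : ℕ) : ℕ∞) ≤
      analyticOrderAt (fun w => Quaternion.normSq (F w)) (conj z) ∧
    (z.im = 0 → ((2 * (2 * s + as.length) : ℕ) : ℕ∞) ≤
      analyticOrderAt (fun w => Quaternion.normSq (F w)) z) := by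
  obtain ⟨E, H, hE, hzE, hczE, hH, heq⟩ := h.exists_normSq_eq hF has
  have hU : IsOpen (D ∩ E) := hDo.inter hE
  have hN := hFh.differentiableOn_normSq.mono (Set.inter_subset_left (t := E))
  have hH' := hH.mono (Set.inter_subset_right (s := D))
  have hlin : ∀ c : ℂ, DifferentiableOn ℂ (fun w : ℂ => w - c) (D ∩ E) := fun c => by fun_prop
  refine ⟨?_, ?_, fun hre => ?_⟩
  · refine natCast_le_analyticOrderAt_of_eqOn hU ⟨hz, hzE⟩ hN
      (((hlin (conj z)).pow (2 * s + as.length)).mul hH') fun w hw => ?_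
    rw [heq w hw, mul_pow, mul_assoc]
    rfl
  · refine natCast_le_analyticOrderAt_of_eqOn hU ⟨hD z hz, hczE⟩ hN
      (((hlin z).pow (2 * s + as.length)).mul hH') fun w hw => ?_
    rw [heq w hw, mul_comm (w - z), mul_pow, mul_assoc]
    rfl
  · refine natCast_le_analyticOrderAt_of_eqOn hU ⟨hz, hzE⟩ hN hH' fun w hw => ?_
    rw [heq w hw, Complex.conj_eq_iff_im.2 hre, ← sq, ← pow_mul]

/-- The bound m makes the supremum a maximum; the first alternative covers the empty supremum. -/
theorem sphericalMult_eq {f : ℍ[ℝ] → ℍ[ℝ]} {z : ℂ} {m : ℕ}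
    (h : ∀ s, Factors f z s [] → s ≤ m) (him : z.im ≠ 0) :
    sphericalMult f z = 0 ∨ ∃ s : ℕ, sphericalMult f z = s ∧ Factors f z s [] := by
  rw [sphericalMult, if_neg him]
  by_cases hex : ∃ s, Factors f z s []
  · right
    have hfin : {s | Factors f z s []}.Finite := (Set.finite_Iic m).subset fun s hs => h s hs
    obtain ⟨s, hs, hmax⟩ := Set.exists_max_image _ id hfin hex
    refine ⟨s, le_antisymm (iSup₂_le fun t ht => ?_) (le_iSup₂_of_le s hs le_rfl), hs⟩
    exact_mod_cast hmax t ht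
  · left
    push Not at hex
    simp [hex]

/-- The total multiplicity of the zeros on `𝕊_z` is at most the order of the normal function. -/
theorem mult_le_of_factors {f : ℍ[ℝ] → ℍ[ℝ]} {z : ℂ} {m : ℕ} (him : z.im ≠ 0)
    (h : ∀ s as, Factors f z s as → (∀ a ∈ as, a ∈ sphereOf z) → 2 * s + as.length ≤ m) :
    punctualMult f z + 2 * sphericalMult f z ≤ m := by
  have h' : ∀ s, Factors f z s [] → s ≤ m := fun s hs => by
    have := h s [] hs (by simp)
    simp at this
    omega
  obtain ⟨s, hs, hle⟩ : ∃ s : ℕ, sphericalMult f z = s ∧ 2 * s ≤ m := by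
    rcases sphericalMult_eq h' him with h0 | ⟨s, hs, hfac⟩
    · exact ⟨0, by simpa using h0, by simp⟩
    · exact ⟨s, hs, by simpa using h s [] hfac (by simp)⟩
  -- The punctual multiplicity only admits factorizations with the maximal s, which leave room for
  -- at most m - 2s linear factors.
  have hp : punctualMult f z ≤ ((m - 2 * s : ℕ) : ℕ∞) := by
    refine iSup_le fun t => iSup₂_le fun as ht => ?_
    obtain ⟨ht, has, hfac⟩ := ht
    rw [hs] at ht
    have ht : t = s := by exact_mod_cast ht
    subst ht
    have := h t as hfac has
    exact_mod_cast (by omega : as.length ≤ m - 2 * t)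
  rw [hs]
  calc punctualMult f z + 2 * (s : ℕ∞) ≤ ((m - 2 * s : ℕ) : ℕ∞) + 2 * (s : ℕ∞) := by gcongr
    _ = ((m - 2 * s + 2 * s : ℕ) : ℕ∞) := by push_cast; rfl
    _ = m := by rw [Nat.sub_add_cancel hle]

theorem mult_le_of_factors_real {f : ℍ[ℝ] → ℍ[ℝ]} {z : ℂ} {m : ℕ} (him : z.im = 0)
    (h : ∀ s as, Factors f z s as → (∀ a ∈ as, a ∈ sphereOf z) → 2 * (2 * s + as.length) ≤ m) :
    2 * (punctualMult f z + 2 * sphericalMult f z) ≤ m := by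
  have hs : sphericalMult f z = 0 := by rw [sphericalMult, if_pos him]
  have hp : punctualMult f z ≤ ((m / 2 : ℕ) : ℕ∞) := by
    refine iSup_le fun t => iSup₂_le fun as ht => ?_
    have := h t as ht.2.2 ht.2.1
    exact_mod_cast (by omega : as.length ≤ m / 2)
  rw [hs, mul_zero, add_zero]
  calc 2 * punctualMult f z ≤ 2 * ((m / 2 : ℕ) : ℕ∞) := by gcongr
    _ ≤ m := by exact_mod_cast Nat.mul_div_le m 2

end Multiplicity

/-! ### Summation over the half plane -/

section Count

/-- `sumOver` of a function that vanishes outside a finite set. -/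
theorem sumOver_le {m : ℂ → ℕ∞} {r : ℝ} {A : Finset ℂ}
    (h : ∀ z, 0 ≤ z.im → ‖z‖ ≤ r → z ∉ A → m z = 0) : sumOver m r ≤ ∑ z ∈ A, m z := by
  refine iSup₂_le fun T hT => ?_
  calc ∑ z ∈ T, m z ≤ ∑ z ∈ T ∪ A, m z :=
        Finset.sum_le_sum_of_subset Finset.subset_union_left
    _ = ∑ z ∈ A, m z := by
        refine (Finset.sum_subset Finset.subset_union_right fun z hz hzA => ?_).symm
        have hzT := (Finset.mem_union.1 hz).resolve_right hzA
        exact h z (hT z hzT).1 (hT z hzT).2 hzA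

open Classical in
/-- If the multiplicities on the upper half plane are dominated by a weight on the whole disc,
with real points counted half, then the sum of the weights dominates twice the count. -/
theorem two_mul_sum_le {m : ℂ → ℕ∞} {ν : ℂ → ℕ} {A : Finset ℂ} (hA : ∀ z ∈ A, 0 ≤ z.im)
    (h1 : ∀ z ∈ A, z.im ≠ 0 → m z ≤ ν z) (h2 : ∀ z ∈ A, z.im ≠ 0 → m z ≤ ν (conj z))
    (h3 : ∀ z ∈ A, z.im = 0 → 2 * m z ≤ ν z) :
    2 * ∑ z ∈ A, m z ≤ ((∑ z ∈ A ∪ A.image conj, ν z : ℕ) : ℕ∞) := by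
  set A' := A.filter fun z => z.im ≠ 0 with hA'
  have hinj : Set.InjOn (fun z : ℂ => conj z) A' := fun a _ b _ hab => by
    simpa using congrArg conj hab
  -- Reflections of non-real points of A lie strictly below the real axis.
  have hdisj : Disjoint A (A'.image fun z => conj z) := by
    rw [Finset.disjoint_left]
    rintro z hz hz'
    obtain ⟨w, hw, rfl⟩ := Finset.mem_image.1 hz'
    have hw' := Finset.mem_filter.1 hw
    have e1 := hA _ hz
    have e2 := hA _ hw'.1
    simp at e1
    exact hw'.2 (le_antisymm e1 e2)
  have hsub : A ∪ A'.image (fun z => conj z) ⊆ A ∪ A.image conj :=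
    Finset.union_subset_union_right (Finset.image_subset_image (Finset.filter_subset _ _))
  calc 2 * ∑ z ∈ A, m z = ∑ z ∈ A, 2 * m z := Finset.mul_sum _ _ _
    _ ≤ ∑ z ∈ A, ((ν z : ℕ∞) + if z.im ≠ 0 then (ν (conj z) : ℕ∞) else 0) := by
        refine Finset.sum_le_sum fun z hz => ?_
        by_cases him : z.im = 0
        · simpa [him] using h3 z hz him
        · rw [if_pos him, two_mul]
          exact add_le_add (h1 z hz him) (h2 z hz him)
    _ = ((∑ z ∈ A, ν z + ∑ z ∈ A', ν (conj z) : ℕ) : ℕ∞) := by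
        rw [Finset.sum_add_distrib, hA', ← Finset.sum_filter]
        push_cast
        rfl
    _ = ((∑ z ∈ A ∪ A'.image (fun z => conj z), ν z : ℕ) : ℕ∞) := by
        rw [Finset.sum_union hdisj, Finset.sum_image hinj]
    _ ≤ _ := by exact_mod_cast Finset.sum_le_sum_of_subset hsub

end Count

end SliceRegular

/-! ### The zero count -/

open Classical in
theorem corollary9 (f : ℍ[ℝ] → ℍ[ℝ]) (D : Set ℂ) (R : ℝ)
    (hDopen : IsOpen D) (hDsymm : SliceRegular.IsSymm D)
    (hball : Metric.closedBall (0 : ℍ[ℝ]) R ⊆ SliceRegular.circularization D)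
    (hf : SliceRegular.IsSliceRegular f D) (hf0 : f 0 ≠ 0)
    (r : ℝ) (hr : 0 < r) (hrR : r < R) :
    ∃ N : ℕ, SliceRegular.zeroCount f r = (N : ℕ∞) ∧
      (N : ℝ) ≤ (Real.log (SliceRegular.maxModulus f R) - Real.log ‖f 0‖) /
        (Real.log R - Real.log r) := by
  obtain ⟨F, -, hFh, hF⟩ := hf
  have hsub := SliceRegular.closedBall_subset_of_circularization hDsymm hball
  have hR : 0 < R := hr.trans hrR
  have h0D : (0 : ℂ) ∈ D := hsub (Metric.mem_closedBall_self hR.le)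
  set N : ℂ → ℂ := fun w => Quaternion.normSq (F w) with hNdef
  have hN0 : N 0 = ((‖f 0‖ ^ 2 : ℝ) : ℂ) := hF.normSq_zero h0D
  have hfpos : 0 < ‖f 0‖ := norm_pos_iff.2 hf0
  obtain ⟨hle, ⟨Z, hZ⟩, htop, hbound⟩ := SliceRegular.analytic_zeros_bound (N := N) hr hrR
    (fun z hz => hFh.differentiableOn_normSq.analyticAt (hDopen.mem_nhds (hsub hz)))
    (by rw [hN0]; exact_mod_cast (pow_pos hfpos 2).ne')
    (fun z hz => hF.norm_normSq_le_maxModulus hFh hDsymm hball hz)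
  set ν : ℂ → ℕ := analyticOrderNatAt N with hν
  have hconj : ∀ z : ℂ, ‖z‖ ≤ r → (starRingEnd ℂ) z ∈ Metric.closedBall (0 : ℂ) r := by
    intro z hz
    simpa using hz
  have hfac : ∀ z : ℂ, ‖z‖ ≤ r → ∀ s as, SliceRegular.Factors f z s as →
      (∀ a ∈ as, a ∈ SliceRegular.sphereOf z) → 2 * s + as.length ≤ ν z ∧
        2 * s + as.length ≤ ν ((starRingEnd ℂ) z) ∧
        (z.im = 0 → 2 * (2 * s + as.length) ≤ ν z) := by
    intro z hz s as h has
    have hzr : z ∈ Metric.closedBall (0 : ℂ) r := by simpa using hz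
    have key := h.le_order hDopen hDsymm hFh hF
      (hsub (Metric.closedBall_subset_closedBall hrR.le hzr)) has
    rw [← Nat.cast_analyticOrderNatAt (htop z hzr),
      ← Nat.cast_analyticOrderNatAt (htop _ (hconj z hz))] at key
    exact_mod_cast key
  set m : ℂ → ℕ∞ := fun z =>
    SliceRegular.punctualMult f z + 2 * SliceRegular.sphericalMult f z with hm
  have h1 : ∀ z : ℂ, ‖z‖ ≤ r → z.im ≠ 0 → m z ≤ ν z := fun z hz him =>
    SliceRegular.mult_le_of_factors him fun s as h has => (hfac z hz s as h has).1
  have h2 : ∀ z : ℂ, ‖z‖ ≤ r → z.im ≠ 0 → m z ≤ ν ((starRingEnd ℂ) z) := fun z hz him =>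
    SliceRegular.mult_le_of_factors him fun s as h has => (hfac z hz s as h has).2.1
  have h3 : ∀ z : ℂ, ‖z‖ ≤ r → z.im = 0 → 2 * m z ≤ ν z := fun z hz him =>
    SliceRegular.mult_le_of_factors_real him fun s as h has => (hfac z hz s as h has).2.2 him
  set A := Z.filter fun z => 0 ≤ z.im ∧ ‖z‖ ≤ r with hAdef
  have hA : ∀ z ∈ A, 0 ≤ z.im ∧ ‖z‖ ≤ r := fun z hz => (Finset.mem_filter.1 hz).2
  have hzero : ∀ z : ℂ, 0 ≤ z.im → ‖z‖ ≤ r → z ∉ A → m z = 0 := by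
    intro z him hz hzA
    have hzZ : z ∉ Z := fun h => hzA (Finset.mem_filter.2 ⟨h, him, hz⟩)
    have hνz : ν z = 0 := hZ z (by simpa using hz) hzZ
    by_cases hre : z.im = 0
    · have := h3 z hz hre
      rw [hνz] at this
      simpa using this
    · have := h1 z hz hre
      rw [hνz] at this
      simpa using this
  have hcount : SliceRegular.zeroCount f r ≤ ∑ z ∈ A, m z := by
    rw [hm, Finset.sum_add_distrib, ← Finset.mul_sum]
    refine add_le_add (SliceRegular.sumOver_le fun z him hz hzA => ?_)
      (mul_le_mul_right (SliceRegular.sumOver_le fun z him hz hzA => ?_) 2)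
    · exact (add_eq_zero.1 (hzero z him hz hzA)).1
    · simpa using (add_eq_zero.1 (hzero z him hz hzA)).2
  have hdouble : 2 * SliceRegular.zeroCount f r ≤
      ((∑ z ∈ A ∪ A.image (starRingEnd ℂ), ν z : ℕ) : ℕ∞) :=
    (mul_le_mul_right hcount 2).trans (SliceRegular.two_mul_sum_le (fun z hz => (hA z hz).1)
      (fun z hz => h1 z (hA z hz).2) (fun z hz => h2 z (hA z hz).2) (fun z hz => h3 z (hA z hz).2))
  -- Finiteness comes from the same inequality, whose right side is a natural number.
  have hne : SliceRegular.zeroCount f r ≠ ⊤ := by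
    intro h
    rw [h] at hdouble
    simp at hdouble
  obtain ⟨n, hn⟩ := ENat.ne_top_iff_exists.1 hne
  refine ⟨n, hn.symm, ?_⟩
  rw [← hn] at hdouble
  have hnat : 2 * n ≤ ∑ z ∈ A ∪ A.image (starRingEnd ℂ), ν z := by exact_mod_cast hdouble
  have hreal := hbound (A ∪ A.image (starRingEnd ℂ)) fun u hu => by
    rcases Finset.mem_union.1 hu with hu | hu
    · simpa using (hA u hu).2
    · obtain ⟨w, hw, rfl⟩ := Finset.mem_image.1 hu
      exact hconj w (hA w hw).2
  have h2n : (2 * n : ℝ) ≤ ((∑ z ∈ A ∪ A.image (starRingEnd ℂ), ν z : ℕ) : ℝ) := by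
    exact_mod_cast hnat
  have hfin := h2n.trans hreal
  -- The squares M_f(R)² and |f(0)|² give a factor 2 in the logarithms, cancelling that of 2n.
  rw [hN0, Complex.norm_real, Real.norm_of_nonneg (by positivity), Real.log_pow, Real.log_pow]
    at hfin
  push_cast at hfin
  rw [← mul_sub, mul_div_assoc] at hfin
  linarith
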